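/- Let $K$ be a field and let $K((\mathbb{R}^{\leq 0}))$ be the ring of generalised power series $b=\sum_{x} b_x t^x$ with coefficients in $K$ and well-ordered support $\operatorname{supp}(b)\subseteq\mathbb{R}^{\leq 0}$; let $\operatorname{ot}(b)$ be the order type of $\operatorname{supp}(b)$. Let $J$ be the ideal generated by the monomials $t^x$ with $x<0$. Put $v_J(b)=0$ if $b\in J$, $v_J(b)=1$ if $b\in (J+K)\setminus J$, and $v_J(b)=\min\{\operatorname{ot}(c): c\equiv b \bmod J+K\}$ otherwise; let $\deg_J(b)$ be the largest ordinal $\alpha$ with $\omega^\alpha\le v_J(b)$ if $b\notin J$, and $\deg_J(b)=-\infty$ if $b\in J$. For an ordinal $\alpha$ let $J_\alpha=\{b:\deg_J(b)<\alpha\}$, a $K$-vector space, and for $b$ with $\deg_J(b)=\alpha$ let $\mathrm{rv}_J(b)$ be the class of $b$ in $\mathrm{RV}_J^\alpha=J_{\alpha+1}/J_\alpha$. If $\alpha=\omega^{\beta_1}+\dots+\omega^{\beta_k}$ with $\beta_1\ge\dots\ge\beta_k$ is the Cantor normal form of $\alpha>0$, put $\alpha^p=\omega^{\beta_k}$ and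 $\alpha^r=\omega^{\beta_1}+\dots+\omega^{\beta_{k-1}}$. For $\gamma\le 0$ let $b^{|\gamma}=t^{-\gamma}\sum_{x\le\gamma}b_xt^x$. Finitely many series $b_1,\dots,b_n$ with common value $\deg_J(b_i)=\alpha$ are called hereditarily $\mathrm{rv}_J$-independent (by induction on $\alpha$) if 1. $\mathrm{rv}_J(b_1),\dots,\mathrm{rv}_J(b_n)$ are $K$-linearly independent in $\mathrm{RV}_J^\alpha$; and 2. if $\alpha>0$ and $\alpha\ne\alpha^p$, there is $\delta<0$ such that for every ordinal $\alpha'$ with $\alpha^r\le\alpha'<\alpha$, all integers $m(1),\dots,m(n)\ge 0$ and all $\gamma_{i,j}\in[\delta,0]$ ($1\le i\le n$, $1\le j\le m(i)$) with $\deg_J(b_i^{|\gamma_{i,j}})=\alpha'$ and $\gamma_{i,j}\ne\gamma_{i,j'}$ for $j\ne j'$, the family of all the $b_i^{|\gamma_{i,j}}$ is hereditarily $\mathrm{rv}_J$-independent (the empty family counts as such). **Proposition.** Let $b_1,\dots,b_n\in K((\mathbb{R}^{\leq 0}))$ satisfy $\deg_J(b_1)=\deg_J(b_i)>0$ for all $i$.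 Suppose that $\overline{\operatorname{supp}(b_i)}\cap\overline{\operatorname{supp}(b_j)}=\{0\}$ whenever $i\neq j$ (closures in $\mathbb{R}$), and that $\bigcup_i\overline{\operatorname{supp}(b_i)}\setminus\{0\}$ is a $\mathbb{Q}$-linearly independent set. Then $b_1,\dots,b_n$ are hereditarily $\mathrm{rv}_J$-independent. -/

import Mathlib

namespace RvIndep

open Ordinal

/-! ### Facts on order types of unions (used to see that `Jlt` below is a vector space) -/

noncomputable section

theorem type_eq_Iio_add_Ici {X : Type} [LinearOrder X] [WellFoundedLT X] (A : Set X) (x : X) :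
    typeLT A = typeLT ↑(A ∩ Set.Iio x) + typeLT ↑(A ∩ Set.Ici x) := by
  rw [← type_sum_lex]
  refine RelIso.ordinalType_congr (RelIso.symm ?_)
  refine RelIso.ofSurjective (RelEmbedding.ofMonotone
    (Sum.elim (fun a ↦ ⟨a.1, a.2.1⟩) (fun a ↦ ⟨a.1, a.2.1⟩)) ?_) ?_
  · rintro (⟨a, ha, hax⟩ | ⟨a, ha, hax⟩) (⟨b, hb, hbx⟩ | ⟨b, hb, hbx⟩) h
    · simpa only [Sum.elim_inl, Subtype.mk_lt_mk] using Subtype.mk_lt_mk.1 (Sum.lex_inl_inl.1 h)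
    · exact Subtype.mk_lt_mk.2 (lt_of_lt_of_le hax hbx)
    · simp at h
    · simpa only [Sum.elim_inr, Subtype.mk_lt_mk] using Subtype.mk_lt_mk.1 (Sum.lex_inr_inr.1 h)
  · rintro ⟨a, ha⟩
    rcases lt_or_ge a x with h | h
    · exact ⟨Sum.inl ⟨a, ha, h⟩, rfl⟩
    · exact ⟨Sum.inr ⟨a, ha, h⟩, rfl⟩

theorem exists_type_inter_Iio {X : Type} [LinearOrder X] [WellFoundedLT X] (A : Set X)
    {o : Ordinal.{0}} (h : o < typeLT A) : ∃ x : X, typeLT ↑(A ∩ Set.Iio x) = o := by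
  obtain ⟨x, rfl⟩ := typein_surj (α := A) (· < ·) h
  refine ⟨x, ?_⟩
  rw [← type_subrel]
  refine RelIso.ordinalType_congr ?_
  exact ⟨⟨fun a ↦ ⟨⟨a.1, a.2.1⟩, a.2.2⟩, fun a ↦ ⟨a.1.1, a.1.2, a.2⟩, fun _ ↦ rfl, fun _ ↦ rfl⟩,
    Iff.rfl⟩

theorem type_union_lt_omega0_opow {X : Type} [LinearOrder X] [WellFoundedLT X] (b : Ordinal.{0}) :
    ∀ A B : Set X, typeLT A < ω ^ b → typeLT B < ω ^ b → typeLT ↑(A ∪ B) < ω ^ b := by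
  induction b using WellFoundedLT.induction with
  | ind b IH =>
  intro A B hA hB
  rcases eq_or_ne b 0 with rfl | hb
  · rw [opow_zero, Order.lt_one_iff, type_eq_zero_iff_isEmpty] at *
    rw [Set.isEmpty_coe_sort] at *
    simp [hA, hB]
  obtain ⟨c₁, hc₁, n₁, h₁⟩ := (lt_omega0_opow hb).1 hA
  obtain ⟨c₂, hc₂, n₂, h₂⟩ := (lt_omega0_opow hb).1 hB
  obtain ⟨c, hcb, n, hAn, hBn⟩ : ∃ c < b, ∃ n : ℕ, typeLT A < ω ^ c * n ∧ typeLT B < ω ^ c * n := by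
    refine ⟨max c₁ c₂, max_lt hc₁ hc₂, max n₁ n₂, h₁.trans_le ?_, h₂.trans_le ?_⟩
    · exact mul_le_mul' (opow_le_opow_right omega0_pos (le_max_left _ _))
        (by exact_mod_cast le_max_left _ _)
    · exact mul_le_mul' (opow_le_opow_right omega0_pos (le_max_right _ _))
        (by exact_mod_cast le_max_right _ _)
  have key : ∀ k : ℕ, ∀ A B : Set X, ω ^ c * k ≤ typeLT ↑(A ∪ B) →
      ∃ i j : ℕ, i + j = k ∧ ω ^ c * i ≤ typeLT A ∧ ω ^ c * j ≤ typeLT B := by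
    intro k
    induction k with
    | zero => exact fun A B _ ↦ ⟨0, 0, rfl, by simp, by simp⟩
    | succ k ih =>
      intro A B h
      rw [Nat.cast_succ, mul_add_one] at h
      have hpos : 0 < ω ^ c := opow_pos _ omega0_pos
      obtain ⟨x, hx⟩ := exists_type_inter_Iio (A ∪ B)
        (lt_of_lt_of_le (lt_add_of_pos_right _ hpos) h)
      rw [type_eq_Iio_add_Ici (A ∪ B) x, hx, add_le_add_iff_left] at h
      rw [Set.union_inter_distrib_right] at hx h
      obtain ⟨i, j, hij, hi, hj⟩ := ih _ _ hx.ge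
      have hor : ω ^ c ≤ typeLT ↑(A ∩ Set.Ici x) ∨ ω ^ c ≤ typeLT ↑(B ∩ Set.Ici x) := by
        by_contra! hcon
        exact (IH c hcb _ _ hcon.1 hcon.2).not_ge h
      rcases hor with hor | hor
      · refine ⟨i + 1, j, by omega, ?_, ?_⟩
        · rw [Nat.cast_succ, mul_add_one, type_eq_Iio_add_Ici A x]
          exact add_le_add hi hor
        · exact hj.trans (type_mono Set.inter_subset_left)
      · refine ⟨i, j + 1, by omega, ?_, ?_⟩
        · exact hi.trans (type_mono Set.inter_subset_left)
        · rw [Nat.cast_succ, mul_add_one, type_eq_Iio_add_Ici B x]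
          exact add_le_add hj hor
  by_contra! hcon
  obtain ⟨i, j, hij, hi, hj⟩ := key (2 * n) A B (le_trans (by
    have := (opow_mul_lt_opow (natCast_lt_omega0 (2 * n)) hcb).le
    simpa using this) hcon)
  rcases le_total n i with h | h
  · exact (hi.trans_lt hAn).not_ge (by gcongr)
  · exact (hj.trans_lt hBn).not_ge (by gcongr; omega)

/-! ### Ordinals: Cantor normal form -/

/-- The exponents `β₁ ≥ β₂ ≥ … ≥ βₙ` of the Cantor normal form
`α = ω ^ β₁ + ⋯ + ω ^ βₙ`, listed with repetitions: `β₁ = log ω α` is the largest exponent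
with `ω ^ β₁ ≤ α`, and one continues with the unique `γ` such that `α = ω ^ β₁ + γ`. -/
def cantorExponents (α : Ordinal.{0}) : List Ordinal.{0} :=
  if h : α = 0 then [] else
    have : α - ω ^ log ω α < α := sub_omega0_opow_log_lt h
    log ω α :: cantorExponents (α - ω ^ log ω α)
termination_by α

/-- The last term `ω ^ βₙ` of the Cantor normal form of `α` (and `0` for `α = 0`). -/
def principalPart (α : Ordinal.{0}) : Ordinal.{0} :=
  ((cantorExponents α).getLast?.map (fun β ↦ ω ^ β)).getD 0

/-- The sum `ω ^ β₁ + ⋯ + ω ^ βₙ₋₁` of all terms but the last one in the Cantor normal form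
of `α`. -/
def residualPart (α : Ordinal.{0}) : Ordinal.{0} :=
  ((cantorExponents α).dropLast.map (fun β ↦ ω ^ β)).sum

/-! ### The ring of generalised power series with exponents in `ℝ^{≤ 0}` -/

/-- The coefficientwise `K`-algebra structure on Hahn series; it is restated here because instance
search would otherwise prefer a structure that passes through power series. -/
instance hahnAlgebra (K : Type*) [Field K] : Algebra K (HahnSeries ℝ K) := HahnSeries.instAlgebra

/-- The subring of the Hahn series over `ℝ` whose (well-ordered) support is contained
in `(-∞, 0]`. -/
def nonposSubalgebra (K : Type*) [Field K] : Subalgebra K (HahnSeries ℝ K) where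
  carrier := {b | b.support ⊆ Set.Iic 0}
  mul_mem' := by
    intro a b ha hb x hx
    obtain ⟨y, hy, z, hz, rfl⟩ := HahnSeries.support_mul_subset hx
    exact add_nonpos (Set.mem_Iic.1 (ha hy)) (Set.mem_Iic.1 (hb hz))
  add_mem' := by
    intro a b ha hb x hx
    rcases HahnSeries.support_add_subset a b hx with h | h
    exacts [ha h, hb h]
  algebraMap_mem' := by
    intro r x hx
    rw [HahnSeries.algebraMap_apply, HahnSeries.C_apply] at hx
    exact (HahnSeries.support_single_subset hx).le

/-- The ring `K((ℝ^{≤ 0}))` of generalised power series with exponents in `ℝ^{≤ 0}`. -/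
def NonposSeries (K : Type*) [Field K] : Type _ := nonposSubalgebra K

instance (K : Type*) [Field K] : CommRing (NonposSeries K) :=
  inferInstanceAs (CommRing (nonposSubalgebra K))

instance (K : Type*) [Field K] : Algebra K (NonposSeries K) :=
  inferInstanceAs (Algebra K (nonposSubalgebra K))

variable {K : Type*} [Field K]

/-- The inclusion of `K((ℝ^{≤ 0}))` into `K((ℝ))`. -/
def toHahn : NonposSeries K →ₐ[K] HahnSeries ℝ K := (nonposSubalgebra K).val

theorem toHahn_injective : Function.Injective (toHahn (K := K)) := Subtype.val_injective

/-- The support of a series, as a set of real numbers. -/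
def supp (b : NonposSeries K) : Set ℝ := (toHahn b).support

instance (b : NonposSeries K) : WellFoundedLT (supp b) :=
  ⟨(toHahn b).isWF_support⟩

/-- The order type of the support of a series. -/
def ot (b : NonposSeries K) : Ordinal.{0} := typeLT (supp b)

/-- The monomial `t ^ x`, for `x ≤ 0`. -/
def tpow (K : Type*) [Field K] (x : ℝ) (hx : x ≤ 0) : NonposSeries K :=
  ⟨HahnSeries.single x 1, fun _ hy ↦ (HahnSeries.support_single_subset hy).le.trans hx⟩

/-- The ideal `J` generated by the monomials `t ^ x` with `x < 0`. -/
def idealJ (K : Type*) [Field K] : Ideal (NonposSeries K) :=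
  Ideal.span {b | ∃ (x : ℝ) (hx : x < 0), b = tpow K x hx.le}

/-- The `K`-vector space `J + K`. -/
def JplusK (K : Type*) [Field K] : Submodule K (NonposSeries K) :=
  (idealJ K).restrictScalars K ⊔ LinearMap.range (Algebra.linearMap K (NonposSeries K))

open Classical in
/-- The ordinal value `v_J`. -/
def vJ (b : NonposSeries K) : Ordinal.{0} :=
  if b ∈ idealJ K then 0
  else if b ∈ JplusK K then 1
  else sInf {o | ∃ c : NonposSeries K, c - b ∈ JplusK K ∧ ot c = o}

open Classical in
/-- The `J`-degree: the Cantor degree of `v_J(b)`, and `-∞` (that is, `⊥`) for `b ∈ J`. -/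
def degJ (b : NonposSeries K) : WithBot Ordinal.{0} :=
  if b ∈ idealJ K then ⊥ else ((log ω (vJ b) : Ordinal.{0}) : WithBot Ordinal.{0})

/-! ### The graded pieces `RV_J^α` -/

theorem ot_add_lt {b c : NonposSeries K} {α : Ordinal.{0}} (hb : ot b < ω ^ α)
    (hc : ot c < ω ^ α) : ot (b + c) < ω ^ α := by
  let U : Set ℝ := supp b ∪ supp c
  have : WellFoundedLT U :=
    ⟨(toHahn b).isWF_support.union (toHahn c).isWF_support⟩
  have aux : ∀ (s : Set ℝ) [WellFoundedLT s], s ⊆ U →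
      typeLT s = typeLT ((fun x : U ↦ (x : ℝ)) ⁻¹' s) := by
    intro s _ hs
    refine RelIso.ordinalType_congr ?_
    exact ⟨⟨fun a ↦ ⟨⟨a.1, hs a.2⟩, a.2⟩, fun a ↦ ⟨a.1.1, a.2⟩, fun _ ↦ rfl, fun _ ↦ rfl⟩,
      Iff.rfl⟩
  have hsub : supp (b + c) ⊆ U := by
    rw [supp, map_add]
    exact HahnSeries.support_add_subset (toHahn b) (toHahn c)
  unfold ot at *
  rw [aux (supp b) Set.subset_union_left] at hb
  rw [aux (supp c) Set.subset_union_right] at hc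
  rw [aux _ hsub]
  refine lt_of_le_of_lt (type_mono ?_) (type_union_lt_omega0_opow α _ _ hb hc)
  intro x hx
  exact hsub hx

theorem ot_smul_le (k : K) (b : NonposSeries K) : ot (k • b) ≤ ot b := by
  have hsub : supp (k • b) ⊆ supp b := by
    rw [supp, map_smul]
    exact HahnSeries.support_smul_subset k (toHahn b)
  rw [ot, ot, type_le_iff']
  exact ⟨⟨Set.embeddingOfSubset _ _ hsub, Iff.rfl⟩⟩

theorem ot_zero : ot (0 : NonposSeries K) = 0 := by
  rw [ot, type_eq_zero_iff_isEmpty, Set.isEmpty_coe_sort]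
  rw [supp, map_zero, HahnSeries.support_zero]

theorem degJ_lt_zero_iff (b : NonposSeries K) :
    degJ b < ((0 : Ordinal.{0}) : WithBot Ordinal.{0}) ↔ b ∈ idealJ K := by
  unfold degJ
  split_ifs with h
  · simp [h]
  · simp only [h, iff_false, not_lt, WithBot.coe_le_coe]
    exact zero_le

theorem idealJ_le_JplusK {b : NonposSeries K} (h : b ∈ idealJ K) : b ∈ JplusK K :=
  (le_sup_left : (idealJ K).restrictScalars K ≤ JplusK K) h

theorem degJ_lt_iff (b : NonposSeries K) {α : Ordinal.{0}} (hα : α ≠ 0) :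
    degJ b < (α : WithBot Ordinal.{0}) ↔
      ∃ c : NonposSeries K, c - b ∈ JplusK K ∧ ot c < ω ^ α := by
  have h1 : (1 : Ordinal.{0}) < ω ^ α := by
    simpa using (opow_lt_opow_iff_right one_lt_omega0).2 (pos_iff_ne_zero.2 hα)
  unfold degJ
  split_ifs with h
  · refine iff_of_true (WithBot.bot_lt_coe _) ⟨0, ?_, ?_⟩
    · simpa using idealJ_le_JplusK h
    · rw [ot_zero]; exact zero_lt_one.trans h1
  · rw [WithBot.coe_lt_coe, ← lt_opow_iff_log_lt' one_lt_omega0 hα, vJ, if_neg h]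
    split_ifs with h'
    · refine iff_of_true h1 ⟨0, ?_, ?_⟩
      · simpa using h'
      · rw [ot_zero]; exact zero_lt_one.trans h1
    · constructor
      · intro hlt
        obtain ⟨c, hc, hco⟩ := csInf_mem
          (s := {o | ∃ c : NonposSeries K, c - b ∈ JplusK K ∧ ot c = o}) ⟨_, b, by simp, rfl⟩
        exact ⟨c, hc, hco.trans_lt hlt⟩
      · rintro ⟨c, hc, hco⟩
        exact lt_of_le_of_lt (csInf_le' ⟨c, hc, rfl⟩) hco

/-- The `K`-vector space `J_α = {b : deg_J(b) < α}`. -/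
def Jlt (K : Type*) [Field K] (α : Ordinal.{0}) : Submodule K (NonposSeries K) where
  carrier := {b | degJ b < (α : WithBot Ordinal.{0})}
  zero_mem' := by
    have : (0 : NonposSeries K) ∈ idealJ K := zero_mem _
    simp [degJ, this]
  add_mem' := by
    intro b c hb hc
    rcases eq_or_ne α 0 with rfl | hα
    · simp only [Set.mem_ofPred_eq, degJ_lt_zero_iff] at *
      exact add_mem hb hc
    · simp only [Set.mem_ofPred_eq, degJ_lt_iff _ hα] at *
      obtain ⟨b', hb', hb''⟩ := hb
      obtain ⟨c', hc', hc''⟩ := hc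
      exact ⟨b' + c', by simpa [add_sub_add_comm] using add_mem hb' hc', ot_add_lt hb'' hc''⟩
  smul_mem' := by
    intro k b hb
    rcases eq_or_ne α 0 with rfl | hα
    · simp only [Set.mem_ofPred_eq, degJ_lt_zero_iff] at *
      exact ((idealJ K).restrictScalars K).smul_mem k hb
    · simp only [Set.mem_ofPred_eq, degJ_lt_iff _ hα] at *
      obtain ⟨b', hb', hb''⟩ := hb
      exact ⟨k • b', by simpa [smul_sub] using (JplusK K).smul_mem k hb',
        (ot_smul_le k b').trans_lt hb''⟩

/-- The `K`-vector space `RV_J^α = J_{α + 1} / J_α`. -/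
abbrev RVJ (K : Type*) [Field K] (α : Ordinal.{0}) : Type _ :=
  Jlt K (α + 1) ⧸ (Jlt K α).submoduleOf (Jlt K (α + 1))

/-- The class `rv_J(b)` in `RV_J^α` of a series `b` of `J`-degree `α`. -/
def rvJ {α : Ordinal.{0}} (b : NonposSeries K) (h : degJ b = (α : WithBot Ordinal.{0})) :
    RVJ K α :=
  Submodule.Quotient.mk ⟨b, by
    change degJ b < ((α + 1 : Ordinal.{0}) : WithBot Ordinal.{0})
    rw [h, WithBot.coe_lt_coe]
    exact lt_add_one α⟩

/-! ### Translated truncations and hereditary independence -/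

/-- The truncation `∑_{x ≤ γ} b_x t^x`. -/
def trunc (γ : ℝ) (b : HahnSeries ℝ K) : HahnSeries ℝ K where
  coeff x := if x ≤ γ then b.coeff x else 0
  isPWO_support' := b.isPWO_support.mono (by
    intro x hx
    simp only [Function.mem_support, ne_eq, ite_eq_right_iff, Classical.not_imp] at hx
    exact hx.2)

/-- The translated truncation `b^{|γ} = t^{-γ} ∑_{x ≤ γ} b_x t^x`. -/
def transTrunc (b : NonposSeries K) (γ : ℝ) : NonposSeries K :=
  ⟨HahnSeries.single (-γ) 1 * trunc γ (toHahn b), by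
    intro x hx
    obtain ⟨y, hy, z, hz, rfl⟩ := HahnSeries.support_mul_subset hx
    have hy' : y = -γ := HahnSeries.support_single_subset hy
    have hz' : z ≤ γ := by
      by_contra hcon
      exact hz (if_neg hcon)
    simp only [Set.mem_Iic]
    linarith⟩

/-- `HeredIndepAt α b`: the members of the finite family `b` all have `J`-degree `α`, and the
family is hereditarily `rv_J`-independent. In the inductive clause, `m i` translated truncations
of `b i` are taken, at the pairwise distinct points `γ i 0, …, γ i (m i - 1)` of `[δ, 0]`. -/
def HeredIndepAt (α : Ordinal.{0}) {ι : Type} (b : ι → NonposSeries K) : Prop :=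
  (∃ h : ∀ i, degJ (b i) = (α : WithBot Ordinal.{0}),
    LinearIndependent K (fun i ↦ rvJ (b i) (h i))) ∧
  (α ≠ principalPart α →
    ∃ δ : ℝ, δ < 0 ∧ ∀ α' : Ordinal.{0}, residualPart α ≤ α' → α' < α →
      ∀ (m : ι → ℕ) (γ : (i : ι) → Fin (m i) → ℝ),
        (∀ i j, δ ≤ γ i j ∧ γ i j ≤ 0) →
        (∀ i, Function.Injective (γ i)) →
        (∀ i j, degJ (transTrunc (b i) (γ i j)) = (α' : WithBot Ordinal.{0})) →
        HeredIndepAt α' (fun p : (i : ι) × Fin (m i) ↦ transTrunc (b p.1) (γ p.1 p.2)))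
termination_by α

/-- The series `b_1, …, b_n` have a common `J`-degree and are hereditarily
`rv_J`-independent. -/
def HeredIndep {n : ℕ} (b : Fin n → NonposSeries K) : Prop :=
  ∃ α : Ordinal.{0}, HeredIndepAt α b

end

end RvIndep

namespace RvIndep

open scoped Ordinal

noncomputable section

variable {K : Type*} [Field K]

/-! ### The residual part of an ordinal -/

/-! Translated truncations compose: truncating `b^{|γ}` at `η ≤ 0` gives `b^{|γ+η}`. So every family
met in the recursive definition consists of series `b_i^{|γ}`, and induction on the degree works for
finite families of these with distinct pairs `(i, γ)` (`heredIndepAt_transTrunc`).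

Linear independence: in positive degree, series with supports disjoint off `0` have independent
classes (`linearIndependent_rvJ`), since no cancellation can lower the degree. If `x < 0` lies in
the supports of `b_i^{|γ}` and `b_j^{|γ'}`, then `(x + γ) + γ' = (x + γ') + γ` relates points of the
closed supports. `ℚ`-independence forces `γ = γ'`, and then `x + γ ≠ 0` lies in both closed
supports, so `i = j`.

Recursive clause: if `δ` is smaller in size than all gaps between the finitely many `γ`, shifts from
`[δ, 0]` keep the pairs distinct. The degrees stay positive because `residualPart_pos` bounds them
below. -/

open Ordinal in
theorem residualPart_pos {α : Ordinal.{0}} (h : α ≠ principalPart α) : 0 < residualPart α := by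
  have hα : α ≠ 0 := by
    rintro rfl
    exact h (by simp [principalPart, cantorExponents])
  have hrec : cantorExponents α = log ω α :: cantorExponents (α - ω ^ log ω α) := by
    rw [cantorExponents, dif_neg hα]
  rcases hl : cantorExponents (α - ω ^ log ω α) with _ | ⟨β, l⟩
  -- A normal form with a single term is its own principal part.
  · refine absurd ?_ h
    have hsub : α - ω ^ log ω α = 0 := by
      by_contra hne
      rw [cantorExponents, dif_neg hne] at hl
      exact List.cons_ne_nil _ _ hl
    have hle : α ≤ ω ^ log ω α := Ordinal.sub_eq_zero_iff_le.1 hsub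
    rw [principalPart, hrec, hl]
    simpa using hle.antisymm (opow_log_le_self ω hα)
  · rw [residualPart, hrec, hl, List.dropLast_cons_of_ne_nil (List.cons_ne_nil _ _),
      List.map_cons, List.sum_cons]
    exact (opow_pos _ omega0_pos).trans_le le_self_add

/-! ### Germs at `0` -/

theorem coeff_eq_zero_of_pos (b : NonposSeries K) {x : ℝ} (hx : 0 < x) :
    (toHahn b).coeff x = 0 := by
  by_contra hne
  exact hx.not_ge (b.2 hne)

/-- All exponents are nonpositive, so multiplication only moves a support further from `0`. -/
theorem exists_coeff_eq_zero_of_mem_idealJ {b : NonposSeries K} (h : b ∈ idealJ K) :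
    ∃ ε : ℝ, ε < 0 ∧ ∀ x, ε < x → (toHahn b).coeff x = 0 := by
  induction h using Submodule.span_induction with
  | mem b hb =>
    obtain ⟨x, hx, rfl⟩ := hb
    exact ⟨x, hx, fun y hy ↦ HahnSeries.coeff_single_of_ne hy.ne'⟩
  | zero => exact ⟨-1, by norm_num, fun x _ ↦ by rw [map_zero, HahnSeries.coeff_zero]⟩
  | add b c _ _ hb hc =>
    obtain ⟨ε, hε, hb⟩ := hb
    obtain ⟨ε', hε', hc⟩ := hc
    refine ⟨max ε ε', max_lt hε hε', fun x hx ↦ ?_⟩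
    rw [map_add, HahnSeries.coeff_add, hb x ((le_max_left _ _).trans_lt hx),
      hc x ((le_max_right _ _).trans_lt hx), add_zero]
  | smul a b _ hb =>
    obtain ⟨ε, hε, hb⟩ := hb
    refine ⟨ε, hε, fun x hx ↦ ?_⟩
    by_contra hne
    rw [smul_eq_mul, map_mul] at hne
    obtain ⟨y, hy, z, hz, rfl⟩ := HahnSeries.support_mul_subset hne
    have hy0 : y ≤ 0 := a.2 hy
    exact hz (hb z (by dsimp only at hx; linarith))

theorem exists_coeff_eq_zero_of_mem_JplusK {b : NonposSeries K} (h : b ∈ JplusK K) :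
    ∃ ε : ℝ, ε < 0 ∧ ∀ x, ε < x → x < 0 → (toHahn b).coeff x = 0 := by
  obtain ⟨c, hc, d, ⟨k, rfl⟩, rfl⟩ := Submodule.mem_sup.1 h
  obtain ⟨ε, hε, hc⟩ := exists_coeff_eq_zero_of_mem_idealJ hc
  refine ⟨ε, hε, fun x hx hx0 ↦ ?_⟩
  rw [map_add, HahnSeries.coeff_add, hc x hx, zero_add, Algebra.linearMap_apply,
    AlgHom.commutes, HahnSeries.algebraMap_apply, HahnSeries.C_apply]
  exact HahnSeries.coeff_single_of_ne hx0.ne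

/-- Such a series is divisible by `t ^ ε`: the quotient still has nonpositive exponents. -/
theorem mem_idealJ_of_coeff_eq_zero {b : NonposSeries K} {ε : ℝ} (hε : ε < 0)
    (h : ∀ x, ε < x → (toHahn b).coeff x = 0) : b ∈ idealJ K := by
  have hsupp : (HahnSeries.single (-ε) (1 : K) * toHahn b).support ⊆ Set.Iic 0 := by
    intro x hx
    obtain ⟨y, hy, z, hz, rfl⟩ := HahnSeries.support_mul_subset hx
    have hy' : y = -ε := HahnSeries.support_single_subset hy
    have hz' : z ≤ ε := not_lt.1 fun hlt ↦ hz (h z hlt)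
    simp only [Set.mem_Iic]
    linarith
  let c : NonposSeries K := ⟨_, hsupp⟩
  have hc : b = c * tpow K ε hε.le := by
    apply toHahn_injective
    change toHahn b = HahnSeries.single (-ε) (1 : K) * toHahn b * HahnSeries.single ε 1
    rw [mul_right_comm, HahnSeries.single_mul_single, neg_add_cancel, mul_one,
      HahnSeries.single_zero_one, one_mul]
  rw [hc]
  exact Ideal.mul_mem_left _ _ (Ideal.subset_span ⟨ε, hε, rfl⟩)

theorem mem_JplusK_of_coeff_eq_zero {b : NonposSeries K} {ε : ℝ} (hε : ε < 0)
    (h : ∀ x, ε < x → x < 0 → (toHahn b).coeff x = 0) : b ∈ JplusK K := by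
  let k : K := (toHahn b).coeff 0
  refine Submodule.mem_sup.2 ⟨b - algebraMap K _ k, ?_, algebraMap K _ k, ⟨k, rfl⟩,
    sub_add_cancel _ _⟩
  refine mem_idealJ_of_coeff_eq_zero hε fun x hx ↦ ?_
  rw [map_sub, HahnSeries.coeff_sub, AlgHom.commutes, HahnSeries.algebraMap_apply,
    HahnSeries.C_apply]
  rcases lt_trichotomy x 0 with hx0 | rfl | hx0
  · rw [h x hx hx0, HahnSeries.coeff_single_of_ne hx0.ne, sub_zero]
  · rw [HahnSeries.coeff_single_same]
    exact sub_self _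
  · rw [coeff_eq_zero_of_pos b hx0, HahnSeries.coeff_single_of_ne hx0.ne', sub_zero]

theorem ot_mono {b c : NonposSeries K} (h : supp b ⊆ supp c) : ot b ≤ ot c := by
  rw [ot, ot, Ordinal.type_le_iff']
  exact ⟨⟨Set.embeddingOfSubset _ _ h, Iff.rfl⟩⟩

/-- The part of a series whose exponents lie in `s`. -/
def restrict (s : Set ℝ) [DecidablePred (· ∈ s)] (b : NonposSeries K) : NonposSeries K :=
  ⟨{ coeff := fun x ↦ if x ∈ s then (toHahn b).coeff x else 0
     isPWO_support' := (toHahn b).isPWO_support.mono (by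
      intro x hx hx'
      simp [hx'] at hx) }, by
    intro x hx
    exact b.2 fun hx' ↦ hx (show (if x ∈ s then (toHahn b).coeff x else 0) = 0 by
      split_ifs <;> [exact hx'; rfl])⟩

theorem coeff_restrict (s : Set ℝ) [DecidablePred (· ∈ s)] (b : NonposSeries K) (x : ℝ) :
    (toHahn (restrict s b)).coeff x = if x ∈ s then (toHahn b).coeff x else 0 := rfl

/-- The `J`-degree is monotone in the germ at `0` of the support. -/
theorem degJ_lt_of_supp_subset {b c : NonposSeries K} {α : Ordinal.{0}} (hα : α ≠ 0)
    {ε : ℝ} (hε : ε < 0) (h : supp b ∩ Set.Ioo ε 0 ⊆ supp c)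
    (hc : degJ c < (α : WithBot Ordinal.{0})) : degJ b < (α : WithBot Ordinal.{0}) := by
  classical
  rw [degJ_lt_iff _ hα] at hc ⊢
  obtain ⟨d, hd, hdα⟩ := hc
  obtain ⟨ε', hε', hd⟩ := exists_coeff_eq_zero_of_mem_JplusK hd
  -- On this interval `c` and `d` have the same coefficients, so the restriction of `b` has its
  -- support inside that of `d`.
  refine ⟨restrict (Set.Ioo (max ε ε') 0) b, ?_, (ot_mono ?_).trans_lt hdα⟩
  · refine mem_JplusK_of_coeff_eq_zero (max_lt hε hε') fun x hx hx0 ↦ ?_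
    rw [map_sub, HahnSeries.coeff_sub, coeff_restrict, if_pos ⟨hx, hx0⟩, sub_self]
  · intro x hx
    have hx' : (toHahn (restrict (Set.Ioo (max ε ε') 0) b)).coeff x ≠ 0 := hx
    rw [coeff_restrict] at hx'
    obtain ⟨⟨hxε, hx0⟩, hxb⟩ := ite_ne_right_iff.1 hx'
    have hxc : (toHahn c).coeff x ≠ 0 := h ⟨hxb, (le_max_left _ _).trans_lt hxε, hx0⟩
    have hdc := hd x ((le_max_right _ _).trans_lt hxε) hx0
    rw [map_sub, HahnSeries.coeff_sub, sub_eq_zero] at hdc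
    change (toHahn d).coeff x ≠ 0
    rwa [hdc]

/-- Series of the same positive `J`-degree whose supports are disjoint away from `0` have
linearly independent classes in `RV_J^α`. -/
theorem linearIndependent_rvJ {ι : Type*} {α : Ordinal.{0}} (hα : α ≠ 0)
    (b : ι → NonposSeries K) (hb : ∀ i, degJ (b i) = (α : WithBot Ordinal.{0}))
    (hdisj : ∀ i j, ∀ x < 0, x ∈ supp (b i) → x ∈ supp (b j) → i = j) :
    LinearIndependent K (fun i ↦ rvJ (b i) (hb i)) := by
  rw [linearIndependent_iff']
  intro s k hsum q hq
  by_contra hk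
  have hmem : degJ (∑ i ∈ s, k i • b i) < (α : WithBot Ordinal.{0}) := by
    let B : ι → Jlt K (α + 1) := fun i ↦ ⟨b i, by
      change degJ (b i) < ((α + 1 : Ordinal.{0}) : WithBot Ordinal.{0})
      rw [hb i, WithBot.coe_lt_coe]
      exact lt_add_one α⟩
    have hmk : ((Jlt K α).submoduleOf (Jlt K (α + 1))).mkQ (∑ i ∈ s, k i • B i) = 0 := by
      rw [map_sum]
      simp only [map_smul]
      exact hsum
    rw [Submodule.mkQ_apply, Submodule.Quotient.mk_eq_zero] at hmk
    have hval : ((∑ i ∈ s, k i • B i : Jlt K (α + 1)) : NonposSeries K) ∈ Jlt K α := hmk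
    rw [Submodule.coe_sum] at hval
    exact hval
  -- The bound `-1` is arbitrary: by disjointness, each negative exponent of `b q` survives in the
  -- sum.
  refine (degJ_lt_of_supp_subset hα (neg_one_lt_zero (R := ℝ)) ?_ hmem).ne (hb q)
  rintro x ⟨hxq, -, hx0⟩
  change (toHahn (∑ i ∈ s, k i • b i)).coeff x ≠ 0
  rw [map_sum, HahnSeries.coeff_sum, Finset.sum_eq_single_of_mem q hq]
  · rw [map_smul, HahnSeries.coeff_smul, smul_eq_mul]
    exact mul_ne_zero hk hxq
  · intro i _ hi
    rw [map_smul, HahnSeries.coeff_smul, smul_eq_mul]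
    by_cases hxi : (toHahn (b i)).coeff x = 0
    · rw [hxi, mul_zero]
    · exact absurd (hdisj i q x hx0 hxi hxq) hi

/-! ### Translated truncations -/

theorem coeff_transTrunc (b : NonposSeries K) (γ x : ℝ) :
    (toHahn (transTrunc b γ)).coeff x = if x ≤ 0 then (toHahn b).coeff (x + γ) else 0 := by
  change (HahnSeries.single (-γ) 1 * trunc γ (toHahn b)).coeff x = _
  have hx : x = (x + γ) + -γ := by ring
  conv_lhs => rw [hx]
  rw [HahnSeries.coeff_single_mul_add, one_mul]
  change (if x + γ ≤ γ then (toHahn b).coeff (x + γ) else 0) = _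
  simp only [add_le_iff_nonpos_left]

theorem add_mem_supp_of_mem_supp_transTrunc {b : NonposSeries K} {γ x : ℝ}
    (h : x ∈ supp (transTrunc b γ)) : x + γ ∈ supp b := by
  have h' : (toHahn (transTrunc b γ)).coeff x ≠ 0 := h
  rw [coeff_transTrunc] at h'
  exact (ite_ne_right_iff.1 h').2

theorem transTrunc_zero (b : NonposSeries K) : transTrunc b 0 = b := by
  apply toHahn_injective
  ext x
  rw [coeff_transTrunc, add_zero]
  split_ifs with h
  · rfl
  · exact (coeff_eq_zero_of_pos b (not_le.1 h)).symm

theorem transTrunc_transTrunc (b : NonposSeries K) (γ : ℝ) {η : ℝ} (hη : η ≤ 0) :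
    transTrunc (transTrunc b γ) η = transTrunc b (γ + η) := by
  apply toHahn_injective
  ext x
  simp only [coeff_transTrunc]
  split_ifs with h h'
  · rw [add_assoc, add_comm η]
  · exact absurd (add_nonpos h hη) h'
  · rfl

/-- If the support stays at distance `ε` from `γ`, the truncation has no exponent above `-ε`, hence
lies in `J`. -/
theorem mem_closure_supp_of_transTrunc_notMem {b : NonposSeries K} {γ : ℝ}
    (h : transTrunc b γ ∉ idealJ K) : γ ∈ closure (supp b) := by
  rw [Metric.mem_closure_iff]
  by_contra! hcon
  obtain ⟨ε, hε, hcon⟩ := hcon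
  refine h (mem_idealJ_of_coeff_eq_zero (neg_lt_zero.2 hε) fun x hx ↦ ?_)
  rw [coeff_transTrunc]
  split_ifs with hx0
  · by_contra hne
    have := hcon (x + γ) hne
    rw [Real.dist_eq, sub_add_cancel_right, abs_neg, abs_of_nonpos hx0] at this
    linarith
  · rfl

/-! ### Hereditary independence -/

/-- Equality would put `y` in the span of `A \ {y}`, as `v + w - u`, or as `(v + w) / 2` when `u =
y`. -/
theorem _root_.LinearIndepOn.add_ne_add {A : Set ℝ} (hA : LinearIndepOn ℚ id A) {y u v w : ℝ}
    (hy : y ∈ A) (hu : u ∈ insert 0 A) (hv : v ∈ insert 0 A) (hw : w ∈ insert 0 A)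
    (hyv : y ≠ v) (hyw : y ≠ w) : y + u ≠ v + w := by
  intro h
  have hspan : ∀ {x : ℝ}, x ∈ insert 0 A → y ≠ x → x ∈ Submodule.span ℚ (A \ {y}) := by
    rintro x (rfl | hx) hyx
    · exact zero_mem _
    · exact Submodule.subset_span ⟨hx, fun h ↦ hyx h.symm⟩
  have hnot : y ∉ Submodule.span ℚ (A \ {y}) := by
    have := hA.notMem_span hy
    simpa using this
  have hvw := add_mem (hspan hv hyv) (hspan hw hyw)
  rw [← h] at hvw
  by_cases hyu : y = u
  · subst hyu
    have := Submodule.smul_mem _ (1 / 2 : ℚ) hvw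
    rw [← two_smul ℚ y, smul_smul] at this
    norm_num at this
    exact hnot this
  · exact hnot (by simpa using sub_mem hvw (hspan hu hyu))

theorem _root_.Set.Finite.exists_neg_lt_sub {S : Set ℝ} (hS : S.Finite) :
    ∃ δ : ℝ, δ < 0 ∧ ∀ x ∈ S, ∀ y ∈ S, x < y → x < y + δ := by
  have hT : ((fun p : ℝ × ℝ ↦ p.1 - p.2) '' (S ×ˢ S)).Finite := (hS.prod hS).image _
  have hev : ∀ᶠ δ : ℝ in nhdsWithin 0 (Set.Iio 0),
      ∀ d ∈ (fun p : ℝ × ℝ ↦ p.1 - p.2) '' (S ×ˢ S), d < 0 → d < δ := by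
    rw [Filter.eventually_all_finite hT]
    intro d _
    by_cases hd : d < 0
    · filter_upwards [Ioo_mem_nhdsLT hd] with δ hδ _ using hδ.1
    · exact Filter.Eventually.of_forall fun _ h ↦ absurd h hd
  obtain ⟨δ, hδ, hδ0⟩ := (hev.and self_mem_nhdsWithin).exists
  refine ⟨δ, hδ0, fun x hx y hy hxy ↦ ?_⟩
  have := hδ (x - y) ⟨(x, y), ⟨hx, hy⟩, rfl⟩ (sub_neg.2 hxy)
  linarith

/-- The form closed under the recursion: the sigma-type family of truncations of truncations is
again of this shape. Positive degree is kept because constants are invisible only there. -/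
theorem heredIndepAt_transTrunc {κ : Type*} (b : κ → NonposSeries K)
    (hcl : ∀ i j, i ≠ j → closure (supp (b i)) ∩ closure (supp (b j)) = {0})
    (hli : LinearIndepOn ℚ id ((⋃ i, closure (supp (b i))) \ {0})) (α : Ordinal.{0}) :
    α ≠ 0 → ∀ {ι : Type} [Finite ι] (i : ι → κ) (γ : ι → ℝ),
      (∀ p, γ p ≤ 0) → (∀ p q, i p = i q → γ p = γ q → p = q) →
      (∀ p, degJ (transTrunc (b (i p)) (γ p)) = (α : WithBot Ordinal.{0})) →
      HeredIndepAt α (fun p ↦ transTrunc (b (i p)) (γ p)) := by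
  induction α using WellFoundedLT.induction with
  | ind α IH =>
  intro hα ι _ i γ hγ hinj hdeg
  have hmem : ∀ p, γ p ∈ closure (supp (b (i p))) := fun p ↦ by
    refine mem_closure_supp_of_transTrunc_notMem fun hJ ↦ ?_
    rw [← degJ_lt_zero_iff, hdeg p, WithBot.coe_lt_coe] at hJ
    exact not_lt_zero hJ
  have hA : ∀ (j : κ) {x : ℝ}, x ∈ closure (supp (b j)) →
      x ∈ insert 0 ((⋃ i, closure (supp (b i))) \ {0}) := fun j x hx ↦ by
    by_cases hx0 : x = 0
    · exact Or.inl hx0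
    · exact Or.inr ⟨Set.mem_iUnion.2 ⟨j, hx⟩, hx0⟩
  rw [HeredIndepAt]
  refine ⟨⟨hdeg, linearIndependent_rvJ hα _ hdeg ?_⟩, fun hα' ↦ ?_⟩
  · intro p q x hx0 hxp hxq
    have hp := subset_closure (add_mem_supp_of_mem_supp_transTrunc hxp)
    have hq := subset_closure (add_mem_supp_of_mem_supp_transTrunc hxq)
    have hp0 : x + γ p ≠ 0 := (add_neg_of_neg_of_nonpos hx0 (hγ p)).ne
    have hpq : γ p = γ q := by
      by_contra hne
      -- The relation `(x + γ p) + γ q = (x + γ q) + γ p`; here `x + γ p` differs from `γ p` because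
      -- `x < 0`.
      refine hli.add_ne_add (y := x + γ p) (u := γ q) (v := x + γ q) (w := γ p)
        ⟨Set.mem_iUnion.2 ⟨_, hp⟩, hp0⟩ (hA _ (hmem q)) (hA _ hq) (hA _ (hmem p))
        (fun h ↦ hne (add_left_cancel h)) (fun h ↦ ?_) (by ring)
      linarith
    refine hinj p q ?_ hpq
    by_contra hne
    rw [← hpq] at hq
    have : x + γ p ∈ ({0} : Set ℝ) := hcl _ _ hne ▸ ⟨hp, hq⟩
    exact hp0 this
  -- This `δ` depends only on the gaps between the points `γ p`, so it serves all `α'` at once.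
  · obtain ⟨δ, hδ, hgap⟩ := (Set.finite_range γ).exists_neg_lt_sub
    refine ⟨δ, hδ, fun α' hrα' hα'α m η hη hηinj hηdeg ↦ ?_⟩
    have hcomp : ∀ p (k : Fin (m p)), transTrunc (transTrunc (b (i p)) (γ p)) (η p k) =
        transTrunc (b (i p)) (γ p + η p k) := fun p k ↦ transTrunc_transTrunc _ _ (hη p k).2
    simp only [hcomp] at hηdeg ⊢
    have hα'0 : α' ≠ 0 := ((residualPart_pos hα').trans_le hrα').ne'
    refine IH α' hα'α hα'0 (ι := (p : ι) × Fin (m p)) (fun p ↦ i p.1)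
      (fun p ↦ γ p.1 + η p.1 p.2) (fun p ↦ add_nonpos (hγ _) (hη _ _).2) ?_
      (fun p ↦ hηdeg p.1 p.2)
    -- Two shifts from `[δ, 0]` differ by at most `-δ`, less than any gap, so shifted points agree
    -- only if the original ones do.
    have hgap' : ∀ p q (k : Fin (m p)) (l : Fin (m q)), γ p + η p k = γ q + η q l →
        ¬ γ p < γ q := fun p q k l h hlt ↦ by
      have := hgap _ ⟨p, rfl⟩ _ ⟨q, rfl⟩ hlt
      linarith [(hη p k).2, (hη q l).1]
    rintro ⟨p, k⟩ ⟨q, l⟩ hi h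
    dsimp only at hi h
    obtain rfl : p = q := hinj p q hi
      (le_antisymm (not_lt.1 (hgap' q p l k h.symm)) (not_lt.1 (hgap' p q k l h)))
    rw [hηinj p (add_left_cancel h)]

end

end RvIndep

open RvIndep in
theorem mainTheorem8 {K : Type*} [Field K] {n : ℕ} (b : Fin n → NonposSeries K)
    (hdeg : ∀ i j, degJ (b i) = degJ (b j))
    (hpos : ∀ i, 0 < degJ (b i))
    (hcl : ∀ i j, i ≠ j → closure (supp (b i)) ∩ closure (supp (b j)) = {0})
    (hli : LinearIndepOn ℚ id ((⋃ i, closure (supp (b i))) \ {0})) :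
    HeredIndep b := by
  obtain ⟨α, hα, hdegα⟩ : ∃ α : Ordinal.{0}, α ≠ 0 ∧
      ∀ i, degJ (b i) = (α : WithBot Ordinal.{0}) := by
    rcases n with _ | n
    -- The empty family has every degree; any nonzero ordinal would do.
    · exact ⟨1, one_ne_zero, fun i ↦ i.elim0⟩
    · obtain ⟨α, hα⟩ := WithBot.ne_bot_iff_exists.1 (hpos 0).ne_bot
      refine ⟨α, ?_, fun i ↦ (hdeg i 0).trans hα.symm⟩
      rintro rfl
      exact (hpos 0).ne hα
  refine ⟨α, ?_⟩
  -- The original series are their own truncations at `0`.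
  have := heredIndepAt_transTrunc b hcl hli α hα id (fun _ ↦ 0) (fun _ ↦ le_rfl)
    (fun _ _ h _ ↦ h) (fun p ↦ by rw [id, transTrunc_zero, hdegα])
  simpa only [id, transTrunc_zero] using this
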